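/- Let $\mathbb K$ be a commutative ring containing $\mathbb Q$, and let $\Lambda_{\mathbb K}=\mathbb K[p_1,p_2,\dots]$ be the ring of symmetric functions over $\mathbb K$ (with $p_k$ the power sums), with Schur functions $s_\lambda$, Hall inner product $\langle s_\lambda,s_\mu\rangle=\delta_{\lambda\mu}$ (extended bilinearly), and operators $f^\perp g=\sum_\mu\langle g,f s_\mu\rangle s_\mu$, so that $f^\perp$ is adjoint to multiplication by $f$. For $f\in\Lambda_{\mathbb K}$ and $g\in\Lambda_{\mathbb Q}$ let $f[g]\in\Lambda_{\mathbb K}$ denote plethysm, that is, the image of $f$ under the $\mathbb K$-algebra homomorphism sending each $p_k$ to the element $p_k[g]$ obtained from $g$ by replacing every $p_j$ by $p_{kj}$. For an integer $i\ge 1$ let $s_i$ denote the Schur function of the one-row partition $(i)$. For a partition $\mu$ let $\mu_1$ be its largest part, with $\mu_1=0$ if $\mu$ is empty. Then for all partitions $\lambda$ and $\mu$ and every positive integer $r$, with $r'=\min(r,\mu_1)$, $$ s_r^\perp\, s_\lambda[s_\mu]=\sum_{(\nu^{(0)},\dots,\nu^{(r')})} \left\langle s_\lambda,\, s_{\nu^{(0)}}s_{\nu^{(1)}}\cdots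 s_{\nu^{(r')}}\right\rangle\; s_{\nu^{(0)}}[s_\mu]\; s_{\nu^{(1)}}[s_1^\perp s_\mu]\; s_{\nu^{(2)}}[s_2^\perp s_\mu]\cdots s_{\nu^{(r')}}[s_{r'}^\perp s_\mu], $$ where the sum is over all sequences of (possibly empty) partitions $(\nu^{(0)},\dots,\nu^{(r')})$ with $\sum_{i=0}^{r'}|\nu^{(i)}|=|\lambda|$ and $\sum_{i=0}^{r'} i\,|\nu^{(i)}|=r$. -/

import Mathlib

/-- The ring of symmetric functions `K[p₁, p₂, …]`; the variable `X k` is the power sum `p_k`. -/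
abbrev SymFun (K : Type*) [CommRing K] : Type _ := MvPolynomial ℕ+ K

namespace SymFun

open MvPolynomial

/-- The power sum `p_{n+1}`. -/
noncomputable def powerSum (K : Type*) [CommRing K] (n : ℕ) : SymFun K := X n.succPNat

/-- The complete symmetric function `h_n`, determined by `h_0 = 1` and
`n h_n = ∑_{i=1}^{n} p_i h_{n-i}`. -/
noncomputable def complete (K : Type*) [CommRing K] [Algebra ℚ K] : ℕ → SymFun K
  | 0 => 1
  | n + 1 => (1 / ((n : ℚ) + 1)) • ∑ i : Fin (n + 1), powerSum K i * complete K (n - i)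

/-- `h_n` for an integer index, with `h_n = 0` for `n < 0`. -/
noncomputable def completeInt (K : Type*) [CommRing K] [Algebra ℚ K] (n : ℤ) : SymFun K :=
  if 0 ≤ n then complete K n.toNat else 0

/-- The Schur function `s_μ = det (h_{μ_i - i + j})`. -/
noncomputable def schur (K : Type*) [CommRing K] [Algebra ℚ K] (μ : YoungDiagram) : SymFun K :=
  Matrix.det (Matrix.of fun i j : Fin (μ.colLen 0) =>
    completeInt K ((μ.rowLen i : ℤ) - (i : ℕ) + (j : ℕ)))

/-! ### The Schur functions form a basis -/

section Formal

variable (K : Type*) [CommRing K]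

/-- The variable with index `n` of a polynomial ring in formal variables, with index `0` read
as `1`. -/
noncomputable def formalVar (n : ℕ) : MvPolynomial ℕ+ K :=
  if h : 0 < n then X (n.toPNat h) else 1

/-- The exponent of the `n`-th formal variable. -/
noncomputable def unitExp (n : ℕ) : ℕ+ →₀ ℕ :=
  if h : 0 < n then Finsupp.single (n.toPNat h) 1 else 0

theorem formalVar_eq (n : ℕ) : formalVar K n = monomial (unitExp n) 1 := by
  unfold formalVar unitExp
  split_ifs
  · rfl
  · simp

theorem prod_formalVar {n : ℕ} (c : Fin n → ℕ) :
    ∏ i, formalVar K (c i) = monomial (∑ i, unitExp (c i)) 1 := by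
  simp only [formalVar_eq, monomial_sum_one]

end Formal

section Basis

set_option linter.unusedSectionVars false

variable (K : Type*) [CommRing K] [Algebra ℚ K]

/-- The polynomial expressing `p_{n+1}` through the `h_k`. -/
noncomputable def formalPsum : ℕ → MvPolynomial ℕ+ K
  | n => ((n : ℚ) + 1) • formalVar K (n + 1) -
      ∑ i : Fin n, formalPsum i * formalVar K (n - i)

/-- Substitution of `h_k` for the `k`-th variable. -/
noncomputable def toSym : MvPolynomial ℕ+ K →ₐ[K] SymFun K := aeval fun k => complete K k

/-- The inverse substitution. -/
noncomputable def ofSym : SymFun K →ₐ[K] MvPolynomial ℕ+ K :=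
  aeval fun k => formalPsum K k.natPred

theorem toSym_formalVar (n : ℕ) : toSym K (formalVar K n) = complete K n := by
  unfold formalVar toSym
  split_ifs with h
  · exact aeval_X _ _
  · obtain rfl : n = 0 := by omega
    simp [complete]

theorem smul_complete (n : ℕ) : ((n : ℚ) + 1) • complete K (n + 1) =
    ∑ i : Fin (n + 1), powerSum K i * complete K (n - i) := by
  rw [complete, smul_smul, mul_one_div_cancel (by positivity), one_smul]

theorem toSym_formalPsum (n : ℕ) : toSym K (formalPsum K n) = powerSum K n := by
  induction n using Nat.strong_induction_on with
  | _ n ih =>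
    rw [formalPsum, map_sub, map_sum, map_rat_smul, toSym_formalVar, smul_complete,
      Fin.sum_univ_castSucc]
    have : ∀ i : Fin n, toSym K (formalPsum K i * formalVar K (n - i)) =
        powerSum K i * complete K (n - i) := fun i => by
      rw [map_mul, ih i i.2, toSym_formalVar]
    simp [this, complete]

theorem ofSym_powerSum (n : ℕ) : ofSym K (powerSum K n) = formalPsum K n := by
  simp [ofSym, powerSum]

theorem ofSym_complete (n : ℕ) : ofSym K (complete K n) = formalVar K n := by
  induction n using Nat.strong_induction_on with
  | _ n ih =>
    cases n with
    | zero => simp [complete, formalVar]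
    | succ n =>
      rw [complete, map_rat_smul, map_sum, Fin.sum_univ_castSucc]
      have : ∀ i : Fin (n + 1), ofSym K (powerSum K i * complete K (n - i)) =
          formalPsum K i * formalVar K (n - i) := fun i => by
        rw [map_mul, ih (n - i) (by omega), ofSym_powerSum]
      have h2 : formalPsum K n * formalVar K (n - n) =
          ((n : ℚ) + 1) • formalVar K (n + 1) -
            ∑ i : Fin n, formalPsum K i * formalVar K (n - i) := by
        rw [← formalPsum]; simp [formalVar]
      have h3 := this (Fin.last n)
      rw [Fin.val_last, h2] at h3
      have h4 : ∀ i : Fin n, ofSym K (powerSum K i * complete K (n - i)) =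
          formalPsum K i * formalVar K (n - i) := fun i => this i.castSucc
      simp only [Fin.val_castSucc, Fin.val_last, h3, h4, add_sub_cancel]
      rw [smul_smul, one_div_mul_cancel (by positivity), one_smul]

/-- The polynomial ring in formal `h_k` is the ring of symmetric functions. -/
noncomputable def formalEquiv : MvPolynomial ℕ+ K ≃ₐ[K] SymFun K :=
  AlgEquiv.ofAlgHom (toSym K) (ofSym K)
    (by
      ext k
      have := toSym_formalPsum K k.natPred
      simpa [ofSym, powerSum] using congrArg (coeff _) this)
    (by
      ext k
      have := ofSym_complete K k
      simp only [formalVar, k.pos, dite_true] at this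
      have h2 : (k : ℕ).toPNat k.pos = k := rfl
      rw [h2] at this
      simpa [toSym] using congrArg (coeff _) this)

theorem formalEquiv_apply (x : MvPolynomial ℕ+ K) : formalEquiv K x = toSym K x := rfl

/-- The exponent of the monomial `∏ h_{μ_i}`. -/
noncomputable def shapeExp (μ : YoungDiagram) : ℕ+ →₀ ℕ :=
  ∑ i : Fin (μ.colLen 0), unitExp (μ.rowLen i)

/-- The determinant of formal variables that maps to `s_μ`. -/
noncomputable def formalSchur (μ : YoungDiagram) : MvPolynomial ℕ+ K :=
  Matrix.det (Matrix.of fun i j : Fin (μ.colLen 0) =>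
    if 0 ≤ (μ.rowLen i : ℤ) - (i : ℕ) + (j : ℕ) then
      formalVar K ((μ.rowLen i : ℤ) - (i : ℕ) + (j : ℕ)).toNat else 0)

theorem formalEquiv_formalSchur (μ : YoungDiagram) :
    formalEquiv K (formalSchur K μ) = schur K μ := by
  rw [formalEquiv_apply, formalSchur, AlgHom.map_det, schur]
  congr 1
  ext1 i j
  simp only [AlgHom.mapMatrix_apply, Matrix.map_apply, Matrix.of_apply, completeInt]
  split_ifs
  · rw [toSym_formalVar]
  · simp

theorem shapeExp_eq (μ : YoungDiagram) :
    shapeExp μ = ((μ.rowLens : Multiset ℕ).map unitExp).sum := by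
  rw [shapeExp, YoungDiagram.rowLens, Finset.sum_fin_eq_sum_range]
  simp only [Multiset.map_coe, List.map_map, Multiset.sum_coe]
  rw [Finset.sum_congr rfl (g := fun i => unitExp (μ.rowLen i))
    (fun i hi => by simp [Finset.mem_range.1 hi])]
  exact Finset.sum_eq_multiset_sum _ _

theorem map_toMultiset_sum (s : Multiset ℕ) (hs : ∀ x ∈ s, 0 < x) :
    (Finsupp.toMultiset (s.map unitExp).sum).map (fun k : ℕ+ => (k : ℕ)) = s := by
  induction s using Multiset.induction_on with
  | empty => simp
  | cons a s ih =>
    have ha := hs a (by simp)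
    simp only [Multiset.map_cons, Multiset.sum_cons, map_add, Multiset.map_add]
    rw [ih fun x hx => hs x (by simp [hx])]
    have : Multiset.map (fun k : ℕ+ => (k : ℕ)) (Finsupp.toMultiset (unitExp a)) = {a} := by
      rw [unitExp, dif_pos ha, Finsupp.toMultiset_single]
      rfl
    rw [this, Multiset.singleton_add]

theorem shapeExp_injective : Function.Injective shapeExp := by
  intro μ ν h
  rw [shapeExp_eq, shapeExp_eq] at h
  have h' := congrArg (fun m => (Finsupp.toMultiset m).map (fun k : ℕ+ => (k : ℕ))) h
  rw [map_toMultiset_sum _ (by simpa using μ.pos_of_mem_rowLens),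
    map_toMultiset_sum _ (by simpa using ν.pos_of_mem_rowLens)] at h'
  apply YoungDiagram.equivListRowLens.injective
  apply Subtype.ext
  exact (Multiset.coe_eq_coe.1 h').eq_of_pairwise (fun a b _ _ h1 h2 => le_antisymm h2 h1)
    μ.rowLens_sorted.pairwise ν.rowLens_sorted.pairwise

theorem sum_map_unitExp (s : Multiset ℕ+) :
    ((s.map (fun k : ℕ+ => (k : ℕ))).map unitExp).sum = Multiset.toFinsupp s := by
  induction s using Multiset.induction_on with
  | empty => simp
  | cons a s ih =>
    have ha : unitExp a = Finsupp.single a 1 := dif_pos a.pos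
    rw [← Multiset.singleton_add, map_add, ← ih]
    simp [ha]

theorem shapeExp_surjective : Function.Surjective shapeExp := by
  intro m
  set s : Multiset ℕ := (Finsupp.toMultiset m).map (fun k : ℕ+ => (k : ℕ)) with hs
  have hw : (s.sort (· ≥ ·)).SortedGE := (Multiset.pairwise_sort s _).sortedGE
  have hpos : ∀ x ∈ s.sort (· ≥ ·), 0 < x := by
    intro x hx
    rw [Multiset.mem_sort, hs, Multiset.mem_map] at hx
    obtain ⟨k, -, rfl⟩ := hx
    exact k.pos
  refine ⟨YoungDiagram.ofRowLens _ hw, ?_⟩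
  rw [shapeExp_eq, YoungDiagram.rowLens_ofRowLens_eq_self hpos, Multiset.sort_eq, hs,
    sum_map_unitExp]
  simp

/-- `∑ k * m_k`. -/
noncomputable def degExp : (ℕ+ →₀ ℕ) →+ ℕ := Finsupp.weight fun k : ℕ+ => (k : ℕ)

/-- `∑ k ^ 2 * m_k`. -/
noncomputable def sqExp : (ℕ+ →₀ ℕ) →+ ℕ := Finsupp.weight fun k : ℕ+ => (k : ℕ) ^ 2

theorem degExp_unitExp (n : ℕ) : degExp (unitExp n) = n := by
  unfold degExp unitExp
  split_ifs with h
  · rw [Finsupp.weight_single, one_smul]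
    rfl
  · rw [map_zero]
    omega

theorem sqExp_unitExp (n : ℕ) : sqExp (unitExp n) = n ^ 2 := by
  unfold sqExp unitExp
  split_ifs with h
  · rw [Finsupp.weight_single, one_smul]
    rfl
  · obtain rfl : n = 0 := by omega
    simp

theorem sqExp_le (m : ℕ+ →₀ ℕ) : sqExp m ≤ degExp m ^ 2 := by
  induction m using Finsupp.induction_linear with
  | zero => simp
  | add f g hf hg =>
    rw [map_add, map_add]
    nlinarith [Nat.zero_le (degExp f * degExp g)]
  | single a b =>
    simp only [sqExp, degExp, Finsupp.weight_single, smul_eq_mul, mul_pow]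
    exact Nat.mul_le_mul_right _ (Nat.le_self_pow (by norm_num) b)

theorem sum_sq_lt {n : ℕ} (a : Fin n → ℤ) (ha : StrictAnti a) (σ : Equiv.Perm (Fin n))
    (hσ : σ ≠ 1) : ∑ i, (a i + (i : ℕ)) ^ 2 < ∑ i, (a i + (σ i : ℕ)) ^ 2 := by
  have hanti : Antivary a (fun i : Fin n => ((i : ℕ) : ℤ)) := by
    intro i j hij
    exact ha.antitone (by simpa using hij.le)
  have key := (hanti.sum_mul_lt_sum_mul_comp_perm_iff (σ := σ)).2 (by
    intro h
    apply hσ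
    have hm : StrictMono σ.symm := by
      intro i j hij
      have h2 := h (i := σ.symm i) (j := σ.symm j) (by simpa using hij)
      have h3 : σ.symm i ≤ σ.symm j := ha.le_iff_ge.1 h2
      exact lt_of_le_of_ne h3 (fun h => hij.ne (σ.symm.injective h))
    have h5 := congrFun (hm.range_inj (strictMono_id (α := Fin n)) |>.1
      (by rw [σ.symm.surjective.range_eq, Set.range_id]))
    ext1 i
    rw [Equiv.Perm.one_apply]
    simpa using (h5 (σ i)).symm)
  simp only [smul_eq_mul] at key
  have hsq : ∑ i : Fin n, ((σ i : ℕ) : ℤ) ^ 2 = ∑ i : Fin n, ((i : ℕ) : ℤ) ^ 2 :=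
    Equiv.sum_comp σ (fun i : Fin n => ((i : ℕ) : ℤ) ^ 2)
  simp only [add_sq, Finset.sum_add_distrib, hsq]
  simp only [mul_assoc, ← Finset.mul_sum]
  linarith

/-- The monomials of the same degree that come later in the triangularity order. -/
def later (m : ℕ+ →₀ ℕ) : Set (ℕ+ →₀ ℕ) := {m' | degExp m' = degExp m ∧ sqExp m < sqExp m'}

theorem formalSchur_sub_mem (μ : YoungDiagram) :
    formalSchur K μ - monomial (shapeExp μ) 1 ∈
      Submodule.span K ((fun m => monomial m (1 : K)) '' later (shapeExp μ)) := by
  classical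
  rw [formalSchur, Matrix.det_apply, ← Finset.add_sum_erase _ _ (Finset.mem_univ 1)]
  have h1 : (Equiv.Perm.sign (1 : Equiv.Perm (Fin (μ.colLen 0))) •
      ∏ i : Fin (μ.colLen 0), (Matrix.of fun i j : Fin (μ.colLen 0) =>
    if 0 ≤ (μ.rowLen i : ℤ) - (i : ℕ) + (j : ℕ) then
      formalVar K ((μ.rowLen i : ℤ) - (i : ℕ) + (j : ℕ)).toNat else 0)
        ((1 : Equiv.Perm (Fin (μ.colLen 0))) i) i) = monomial (shapeExp μ) 1 := by
    simp [shapeExp, prod_formalVar]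
  rw [h1, add_sub_cancel_left]
  refine Submodule.sum_mem _ fun σ hσ => ?_
  have hσ1 : σ ≠ 1 := (Finset.mem_erase.1 hσ).1
  rw [Units.smul_def]
  refine zsmul_mem ?_ _
  rw [← Equiv.prod_comp σ⁻¹]
  simp only [Matrix.of_apply, Equiv.Perm.inv_def, Equiv.apply_symm_apply]
  by_cases hneg : ∃ i : Fin (μ.colLen 0), (μ.rowLen i : ℤ) - (i : ℕ) + (σ.symm i : ℕ) < 0
  · obtain ⟨i, hi⟩ := hneg
    rw [Finset.prod_eq_zero (Finset.mem_univ i) (by rw [if_neg (by omega)])]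
    exact zero_mem _
  push Not at hneg
  simp only [hneg, if_true, prod_formalVar]
  refine Submodule.subset_span ⟨_, ⟨?_, ?_⟩, rfl⟩
  · rw [shapeExp, map_sum, map_sum]
    simp only [degExp_unitExp]
    zify
    rw [Finset.sum_congr rfl (fun i _ => Int.toNat_of_nonneg (hneg i))]
    simp only [Finset.sum_add_distrib, Finset.sum_sub_distrib]
    rw [Equiv.sum_comp σ.symm (fun i => ((i : ℕ) : ℤ))]
    ring
  · rw [shapeExp, map_sum, map_sum]
    simp only [sqExp_unitExp]
    zify
    simp only [Int.toNat_of_nonneg (hneg _)]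
    have := sum_sq_lt (fun i : Fin (μ.colLen 0) => (μ.rowLen i : ℤ) - (i : ℕ)) (by
      intro i j hij
      have := μ.rowLen_anti i j (by exact_mod_cast hij.le)
      have : (i : ℕ) < j := hij
      simp only
      omega) σ.symm (by
        intro h
        exact hσ1 (by rw [← Equiv.symm_symm σ, h]; rfl))
    simpa using this

theorem monomial_mem_span (m : ℕ+ →₀ ℕ) :
    monomial m (1 : K) ∈ Submodule.span K (Set.range (formalSchur K)) := by
  induction hk : degExp m ^ 2 - sqExp m using Nat.strong_induction_on generalizing m with
  | _ k ih =>
    obtain ⟨μ, rfl⟩ := shapeExp_surjective m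
    have h := formalSchur_sub_mem K μ
    have hle : Submodule.span K ((fun m => monomial m (1 : K)) '' later (shapeExp μ)) ≤
        Submodule.span K (Set.range (formalSchur K)) := by
      rw [Submodule.span_le]
      rintro _ ⟨m', ⟨h1, h2⟩, rfl⟩
      have := sqExp_le m'
      refine ih (degExp m' ^ 2 - sqExp m') ?_ m' rfl
      rw [h1] at *
      omega
    have := Submodule.sub_mem _ (Submodule.subset_span (Set.mem_range_self μ)) (hle h)
    simpa using this

theorem coeff_formalSchur (μ : YoungDiagram) (m : ℕ+ →₀ ℕ) (hm : m ∉ later (shapeExp μ)) :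
    coeff m (formalSchur K μ) = if shapeExp μ = m then 1 else 0 := by
  classical
  have h : ∀ x ∈ Submodule.span K ((fun m => monomial m (1 : K)) '' later (shapeExp μ)),
      coeff m x = 0 := by
    intro x hx
    induction hx using Submodule.span_induction with
    | mem x hx =>
      obtain ⟨m', hm', rfl⟩ := hx
      rw [coeff_monomial, if_neg]
      rintro rfl
      exact hm hm'
    | zero => simp
    | add x y _ _ hx hy => simp [hx, hy]
    | smul a x _ hx => simp [hx]
  have := h _ (formalSchur_sub_mem K μ)
  rw [coeff_sub, coeff_monomial, sub_eq_zero] at this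
  rw [this]

theorem linearIndependent_formalSchur : LinearIndependent K (formalSchur K) := by
  classical
  rw [linearIndependent_iff']
  intro s g hg
  by_contra! hcon
  obtain ⟨i, his, hi⟩ := hcon
  obtain ⟨μ, hμ, hmin⟩ := (s.filter fun μ => g μ ≠ 0).exists_min_image
    (fun μ => sqExp (shapeExp μ)) ⟨i, by simp [his, hi]⟩
  rw [Finset.mem_filter] at hμ
  have h := congrArg (coeff (shapeExp μ)) hg
  rw [coeff_sum, Finset.sum_eq_single_of_mem μ hμ.1] at h
  · rw [coeff_smul, coeff_formalSchur K μ _ (fun h => lt_irrefl _ h.2)] at h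
    exact hμ.2 (by simpa using h)
  · intro ν hν hne
    rw [coeff_smul]
    by_cases h0 : g ν = 0
    · simp [h0]
    · rw [coeff_formalSchur, if_neg (fun h => hne (shapeExp_injective h)), smul_zero]
      intro h
      exact absurd h.2 (not_lt.2 (hmin ν (by simp [hν, h0])))

theorem span_formalSchur : ⊤ ≤ Submodule.span K (Set.range (formalSchur K)) := by
  intro x _
  induction x using MvPolynomial.induction_on' with
  | monomial m a =>
    have := Submodule.smul_mem _ a (monomial_mem_span K m)
    simpa [smul_monomial] using this
  | add x y hx hy => exact add_mem (hx trivial) (hy trivial)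

/-- The basis of the ring of symmetric functions that consists of the Schur functions. -/
noncomputable def schurBasis : Module.Basis YoungDiagram K (SymFun K) :=
  (Module.Basis.mk (linearIndependent_formalSchur K) (span_formalSchur K)).map
    (formalEquiv K).toLinearEquiv

@[simp]
theorem schurBasis_apply (μ : YoungDiagram) : schurBasis K μ = schur K μ := by
  simp [schurBasis, formalEquiv_formalSchur]

end Basis

/-- The Hall inner product: the bilinear form for which the Schur functions are orthonormal. -/
noncomputable def hall {K : Type*} [CommRing K] [Algebra ℚ K] (f g : SymFun K) : K :=
  ((schurBasis K).repr f).sum fun μ a => a * (schurBasis K).repr g μ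

open Classical in
theorem hall_schur (K : Type*) [CommRing K] [Algebra ℚ K] (μ ν : YoungDiagram) :
    hall (schur K μ) (schur K ν) = if μ = ν then 1 else 0 := by
  rw [hall, ← schurBasis_apply, ← schurBasis_apply, Module.Basis.repr_self,
    Module.Basis.repr_self]
  simp [Finsupp.single_apply, eq_comm]

/-- The operator `f^⊥`, by `f^⊥ g = ∑_μ ⟨g, f s_μ⟩ s_μ`
(a sum with finitely many nonzero terms). -/
noncomputable def perp {K : Type*} [CommRing K] [Algebra ℚ K] (f g : SymFun K) : SymFun K :=
  ∑ᶠ μ : YoungDiagram, hall g (f * schur K μ) • schur K μ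

/-- Plethysm by a power sum: `p_r[g]` for `g` with rational coefficients is obtained from `g`
by replacing each `p_k` with `p_{r k}`. -/
noncomputable def psumPlethysm (r : ℕ+) (g : SymFun ℚ) : SymFun ℚ :=
  rename (fun k => r * k) g

/-- The plethysm `f[g]`, for `g` with rational coefficients: the image of `f` under the
`K`-algebra homomorphism that sends each `p_r` to `p_r[g]`. -/
noncomputable def plethysm {K : Type*} [CommRing K] [Algebra ℚ K] (f : SymFun K)
    (g : SymFun ℚ) : SymFun K :=
  aeval (fun r : ℕ+ => MvPolynomial.map (algebraMap ℚ K) (psumPlethysm r g)) f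

/-- The one-row partition `(r)`. -/
def row (r : ℕ) : YoungDiagram := YoungDiagram.ofRowLens [r] (List.pairwise_singleton _ r).sortedGE

end SymFun

/-! Let `shift` be the algebra homomorphism `p_k ↦ p_k + t^k`. Multiplication by `p_k` is adjoint to
`k ∂/∂p_k`, and the `h_r` have generating function `exp (∑ p_k t^k / k)`, so Taylor's formula gives
`shift = ∑ t^r h_r^⊥` (`hallForm_coeff_shift`). Hence `s_r^⊥ s_λ[s_μ]` is the `t^r`-coefficient of a
homomorphism applied to a plethysm, namely of `s_λ[∑ t^i s_i^⊥ s_μ]`, where `p_k[·]` also replaces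
`t` by `t^k` (`shift_psumPlethysm`).

The argument is a sum of alphabets. Since the coproduct is adjoint to multiplication, `s_λ` of the
sum is `∑ ⟨s_λ, ∏ s_{ν_i}⟩ ∏ s_{ν_i}[i-th summand]` (`exists_aeval_sum_eq`). Homogeneity of
`s_{ν_i}` extracts `t^(i|ν_i|)`, and the coefficient of `t^r` is the claim. Summands with `i > r`
cannot reach `t^r`, and those with `i > μ_1` vanish.

The adjunctions hold for the form that makes power sum monomials orthogonal, while `hall` is defined
by orthonormality of the Schur functions. The two are identified by proving Jacobi-Trudi
determinants orthonormal for the first form (`hallForm_jacobiTrudi`): `h_r^⊥ s_a` vanishes for `r >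
a_0`, and `h_{a_0}^⊥` deletes the first row. -/

namespace SymFun

open MvPolynomial

/-! ### The power sum form -/

section PowerForm

variable {σ : Type*} {K : Type*} [CommRing K]

/-- The squared norm `∏ w_s ^ a_s * a_s!` of the monomial with exponent `a`. -/
noncomputable def normSq (w : σ → ℕ) (a : σ →₀ ℕ) : ℕ :=
  a.prod fun s n => w s ^ n * n.factorial

/-- The bilinear form on a polynomial ring for which the monomials are orthogonal, with the
monomial of exponent `a` of squared norm `∏ w_s ^ a_s * a_s!`. -/
noncomputable def powerForm (K : Type*) [CommRing K] (w : σ → ℕ) :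
    MvPolynomial σ K →ₗ[K] MvPolynomial σ K →ₗ[K] K :=
  (basisMonomials σ K).constr K fun a => (normSq w a : K) • lcoeff K a

theorem powerForm_monomial (w : σ → ℕ) (a : σ →₀ ℕ) (g : MvPolynomial σ K) :
    powerForm K w (monomial a 1) g = normSq w a * coeff a g := by
  have := (basisMonomials σ K).constr_basis K (fun a => (normSq w a : K) • lcoeff K a) a
  rw [coe_basisMonomials] at this
  rw [powerForm, this]
  simp

theorem powerForm_eq_sum (w : σ → ℕ) (f g : MvPolynomial σ K) :
    powerForm K w f g = ∑ a ∈ f.support, coeff a f * (normSq w a * coeff a g) := by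
  conv_lhs => rw [f.as_sum, map_sum, LinearMap.sum_apply]
  refine Finset.sum_congr rfl fun a _ => ?_
  rw [← mul_one (coeff a f), ← smul_eq_mul, ← smul_monomial, map_smul, LinearMap.smul_apply,
    powerForm_monomial, smul_eq_mul, smul_eq_mul, mul_one]

theorem powerForm_comm (w : σ → ℕ) (f g : MvPolynomial σ K) :
    powerForm K w f g = powerForm K w g f := by
  classical
  have h : powerForm K w = (powerForm K w).flip := by
    refine (basisMonomials σ K).ext fun a => (basisMonomials σ K).ext fun b => ?_
    simp only [coe_basisMonomials, LinearMap.flip_apply, powerForm_monomial, coeff_monomial]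
    by_cases hab : a = b
    · simp [hab]
    · simp [hab, Ne.symm hab]
  exact congrArg (fun l => l f g) h

theorem powerForm_one (w : σ → ℕ) (g : MvPolynomial σ K) :
    powerForm K w 1 g = constantCoeff g := by
  have := powerForm_monomial (K := K) w 0 g
  simpa [normSq, constantCoeff_eq] using this

theorem powerForm_C (w : σ → ℕ) (a : K) (g : MvPolynomial σ K) :
    powerForm K w (C a) g = a * constantCoeff g := by
  rw [← mul_one (C a), C_mul', map_smul (powerForm K w), LinearMap.smul_apply, powerForm_one,
    smul_eq_mul]

theorem normSq_add_single (w : σ → ℕ) (a : σ →₀ ℕ) (s : σ) :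
    normSq w (a + Finsupp.single s 1) = normSq w a * (w s * (a s + 1)) := by
  classical
  have h : ∀ b : σ →₀ ℕ, b.support ⊆ a.support ∪ {s} →
      normSq w b = ∏ t ∈ a.support ∪ {s}, w t ^ b t * (b t).factorial := fun b hb =>
    Finsupp.prod_of_support_subset _ hb _ (by simp)
  rw [h a Finset.subset_union_left, h (a + Finsupp.single s 1)
    (Finsupp.support_add.trans (Finset.union_subset_union_right Finsupp.support_single_subset)),
    ← Finset.mul_prod_erase _ _ (show s ∈ a.support ∪ {s} by simp),
    ← Finset.mul_prod_erase (a.support ∪ {s}) (fun t => w t ^ a t * (a t).factorial)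
      (show s ∈ a.support ∪ {s} by simp)]
  have h2 : ∀ t ∈ (a.support ∪ {s}).erase s,
      w t ^ (a + Finsupp.single s 1 : σ →₀ ℕ) t * ((a + Finsupp.single s 1 : σ →₀ ℕ) t).factorial =
        w t ^ a t * (a t).factorial := fun t ht => by
    simp [Finset.ne_of_mem_erase ht]
  rw [Finset.prod_congr rfl h2]
  simp [Nat.factorial_succ]
  ring

/-- Multiplication by a variable is adjoint to the weighted partial derivative. -/
theorem powerForm_X_mul (w : σ → ℕ) (s : σ) (f g : MvPolynomial σ K) :
    powerForm K w (X s * f) g = powerForm K w f (w s • pderiv s g) := by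
  induction f using MvPolynomial.induction_on' with
  | monomial a c =>
    rw [show monomial a c = c • monomial a 1 by simp [smul_monomial], mul_smul_comm,
      map_smul (powerForm K w), map_smul (powerForm K w),
      LinearMap.smul_apply, LinearMap.smul_apply, mul_comm (X s), ← pow_one (X s), ← monomial_add_single,
      powerForm_monomial, powerForm_monomial, coeff_smul, coeff_pderiv, normSq_add_single]
    simp only [Nat.cast_mul, Nat.cast_add, Nat.cast_one, nsmul_eq_mul, smul_eq_mul]
    ring
  | add p q hp hq => rw [mul_add, map_add, map_add, LinearMap.add_apply, LinearMap.add_apply, hp, hq]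

theorem powerForm_mul_X (w : σ → ℕ) (s : σ) (f g : MvPolynomial σ K) :
    powerForm K w f (X s * g) = powerForm K w (w s • pderiv s f) g := by
  rw [powerForm_comm, powerForm_X_mul, powerForm_comm]

theorem powerForm_eq_zero_of_degree_ne (w d : σ → ℕ) {f g : MvPolynomial σ K} {m n : ℕ}
    (hf : IsWeightedHomogeneous d f m) (hg : IsWeightedHomogeneous d g n) (h : m ≠ n) :
    powerForm K w f g = 0 := by
  rw [powerForm_eq_sum]
  refine Finset.sum_eq_zero fun a ha => ?_
  rw [hg.coeff_eq_zero a (by rw [hf (mem_support_iff.1 ha)]; exact h), mul_zero, mul_zero]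

end PowerForm

/-! ### Complete symmetric functions with integer index -/

section Complete

variable (K : Type*) [CommRing K] [Algebra ℚ K]

theorem rat_smul_injective {M : Type*} [AddCommGroup M] [Module ℚ M] {q : ℚ} (hq : q ≠ 0) {x y : M}
    (h : q • x = q • y) : x = y := by
  simpa [smul_smul, hq] using congrArg (q⁻¹ • ·) h

theorem completeInt_of_neg {z : ℤ} (hz : z < 0) : completeInt K z = 0 := if_neg (by omega)

theorem completeInt_natCast (n : ℕ) : completeInt K n = complete K n := by
  simp [completeInt]

theorem completeInt_zero : completeInt K 0 = 1 := by
  simp [completeInt, complete]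

/-- Newton's recurrence. The length `N` is free, as extra terms have negative index; recurrences for
different `z` can then be summed over one range. -/
theorem smul_completeInt {z : ℤ} {N : ℕ} (hN : z ≤ N) : (z : ℚ) • completeInt K z =
    ∑ i ∈ Finset.range N, powerSum K i * completeInt K (z - 1 - i) := by
  rcases lt_trichotomy z 0 with hz | rfl | hz
  · rw [completeInt_of_neg K hz, smul_zero, Finset.sum_eq_zero]
    intro i _
    rw [completeInt_of_neg K (by omega), mul_zero]
  · rw [Int.cast_zero, zero_smul, Finset.sum_eq_zero]
    intro i _
    rw [completeInt_of_neg K (by omega), mul_zero]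
  · obtain ⟨n, rfl⟩ : ∃ n : ℕ, z = (n + 1 : ℕ) := ⟨(z - 1).toNat, by omega⟩
    rw [← Finset.sum_subset (Finset.range_mono (show n + 1 ≤ N by omega)), completeInt_natCast,
      Finset.sum_range]
    · have := smul_complete K n
      push_cast at this ⊢
      rw [this]
      refine Finset.sum_congr rfl fun i _ => ?_
      rw [← completeInt_natCast, Nat.cast_sub (by omega)]
      congr 2
      ring
    · intro i _ hi
      rw [Finset.mem_range] at hi
      rw [completeInt_of_neg K (by push_cast; omega), mul_zero]

theorem completeInt_induction {P : ℤ → Prop} (hneg : ∀ z < 0, P z) (h0 : P 0)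
    (hpos : ∀ z > 0, (∀ y < z, P y) → P z) (z : ℤ) : P z := by
  have key : ∀ n : ℕ, ∀ z : ℤ, z < n → P z := by
    intro n
    induction n with
    | zero => exact fun z hz => hneg z (by simpa using hz)
    | succ n ih =>
      intro z hz
      rcases lt_trichotomy z 0 with h | rfl | h
      · exact hneg z h
      · exact h0
      · exact hpos z h fun y hy => ih y (by push_cast at hz; omega)
  exact key (z + 1).toNat z (by omega)

/-- Differentiating Newton's recurrence gives `(z - j) h_{z-j}` from the factors `h` and `j h_{z-j}`
from the factor `p_j`. -/
theorem pderiv_completeInt (j : ℕ+) (z : ℤ) :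
    (j : ℕ) • pderiv j (completeInt K z) = completeInt K (z - j) := by
  have hj := j.pos
  induction z using completeInt_induction with
  | hneg z hz =>
    rw [completeInt_of_neg K hz, completeInt_of_neg K (by omega), map_zero, smul_zero]
  | h0 => rw [completeInt_zero, completeInt_of_neg K (by omega)]; simp
  | hpos z hz ih =>
    refine rat_smul_injective (q := z) (by exact_mod_cast hz.ne') ?_
    -- The summand `j` keeps the index of `p_j` in range even when `z < j`.
    set N := z.toNat + j with hN
    have hzN : z ≤ N := by omega
    rw [smul_comm (z : ℚ), ← map_rat_smul (pderiv (R := K) j), smul_completeInt K hzN, map_sum,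
      Finset.smul_sum]
    have h1 : ∀ i ∈ Finset.range N,
        (j : ℕ) • pderiv j (powerSum K i * completeInt K (z - 1 - i)) =
          powerSum K i * completeInt K (z - j - 1 - i) +
            if i = j.natPred then (j : ℕ) • completeInt K (z - j) else 0 := fun i _ => by
      rw [Derivation.leibniz, smul_add, smul_eq_mul, ← mul_smul_comm, ih _ (by omega)]
      congr 1
      · congr 2
        ring
      · rw [powerSum, pderiv_X, Pi.single_apply]
        by_cases h : i = j.natPred
        · subst h
          rw [PNat.succPNat_natPred, if_pos rfl, if_pos rfl, smul_eq_mul, mul_one]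
          congr 2
          have : (j.natPred : ℕ) + 1 = j := PNat.natPred_add_one j
          omega
        · rw [if_neg h, if_neg, smul_zero, smul_zero]
          rintro rfl
          exact h (Nat.natPred_succPNat i).symm
    rw [Finset.sum_congr rfl h1, Finset.sum_add_distrib, ← smul_completeInt K (by omega),
      Finset.sum_ite_eq', if_pos (by
        have : (j.natPred : ℕ) + 1 = j := PNat.natPred_add_one j
        rw [Finset.mem_range]; omega), ← Nat.cast_smul_eq_nsmul ℚ, ← add_smul]
    congr 1
    push_cast
    ring

theorem constantCoeff_completeInt (z : ℤ) :
    constantCoeff (completeInt K z) = if z = 0 then 1 else 0 := by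
  rcases lt_trichotomy z 0 with hz | rfl | hz
  · rw [completeInt_of_neg K hz, map_zero, if_neg hz.ne]
  · simp [completeInt_zero]
  · rw [if_neg hz.ne']
    refine rat_smul_injective (q := z) (by exact_mod_cast hz.ne') ?_
    rw [← map_rat_smul (constantCoeff : SymFun K →+* K), smul_completeInt K (N := z.toNat) (by omega),
      map_sum, smul_zero]
    refine Finset.sum_eq_zero fun i _ => ?_
    rw [map_mul, powerSum, constantCoeff_X, zero_mul]

/-- The substitution `p_k ↦ p_k + t ^ k`; the coefficients of its values are the images under
the adjoints of the multiplications by complete symmetric functions. -/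
noncomputable def shift (K : Type*) [CommRing K] : SymFun K →ₐ[K] Polynomial (SymFun K) :=
  aeval fun k => Polynomial.C (X k) + Polynomial.X ^ (k : ℕ)

theorem shift_X (K : Type*) [CommRing K] (k : ℕ+) :
    shift K (X k) = Polynomial.C (X k) + Polynomial.X ^ (k : ℕ) := by
  simp [shift]

theorem shift_powerSum (K : Type*) [CommRing K] (i : ℕ) :
    shift K (powerSum K i) = Polynomial.C (powerSum K i) + Polynomial.X ^ (i + 1) := by
  simp [powerSum, shift_X]

/-- The substitution multiplies the generating function `∑ h_z u^z` by `1 / (1 - t u)`; this is the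
recurrence after clearing the denominator. -/
theorem shift_completeInt (z : ℤ) : shift K (completeInt K z) =
    Polynomial.C (completeInt K z) + Polynomial.X * shift K (completeInt K (z - 1)) := by
  induction z using completeInt_induction with
  | hneg z hz => simp [completeInt_of_neg K hz, completeInt_of_neg K (show z - 1 < 0 by omega)]
  | h0 => simp [completeInt_zero, completeInt_of_neg]
  | hpos z hz ih =>
    refine rat_smul_injective (q := z) (by exact_mod_cast hz.ne') ?_
    set N := z.toNat with hN
    have hzN : z ≤ N := by omega
    set F : ℕ → Polynomial (SymFun K) := fun i => shift K (completeInt K (z - 1 - i)) with hF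
    have h1 : (z : ℚ) • shift K (completeInt K z) = ∑ i ∈ Finset.range N,
        (Polynomial.C (powerSum K i) + Polynomial.X ^ (i + 1)) * F i := by
      rw [← map_rat_smul, smul_completeInt K hzN, map_sum]
      simp only [map_mul, shift_powerSum, hF]
    have h2 : ((z : ℚ) - 1) • shift K (completeInt K (z - 1)) = ∑ i ∈ Finset.range N,
        (Polynomial.C (powerSum K i) + Polynomial.X ^ (i + 1)) * F (i + 1) := by
      have := smul_completeInt K (z := z - 1) (N := N) (by omega)
      push_cast at this
      rw [← map_rat_smul, this, map_sum]
      simp only [map_mul, shift_powerSum, hF]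
      refine Finset.sum_congr rfl fun i _ => ?_
      rw [show z - 1 - ((i + 1 : ℕ) : ℤ) = z - 1 - 1 - i by push_cast; ring]
    have h3 : (z : ℚ) • Polynomial.C (completeInt K z) = ∑ i ∈ Finset.range N,
        Polynomial.C (powerSum K i) * (F i - Polynomial.X * F (i + 1)) := by
      rw [← map_rat_smul (Polynomial.C : SymFun K →+* _), smul_completeInt K hzN, map_sum]
      refine Finset.sum_congr rfl fun i _ => ?_
      rw [map_mul, hF]
      simp only
      rw [ih (z - 1 - i) (by omega)]
      congr 1
      rw [show z - 1 - ((i + 1 : ℕ) : ℤ) = z - 1 - i - 1 by push_cast; ring]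
      ring
    have h4 : ∑ i ∈ Finset.range N, (Polynomial.X ^ (i + 1) * F i -
        Polynomial.X ^ (i + 2) * F (i + 1)) = Polynomial.X * shift K (completeInt K (z - 1)) := by
      rw [Finset.sum_range_sub' (fun i => Polynomial.X ^ (i + 1) * F i)]
      have : F N = 0 := by
        rw [hF]
        simp only
        rw [completeInt_of_neg K (by omega), map_zero]
      rw [this, mul_zero, sub_zero, zero_add, pow_one, hF]
      simp
    have h5 : ((z : ℚ) - 1) • shift K (completeInt K (z - 1)) =
        (z : ℚ) • shift K (completeInt K (z - 1)) - shift K (completeInt K (z - 1)) := by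
      rw [sub_smul, one_smul]
    -- In `h1 - t * h2` the power sum parts form `h3`, and the remaining parts telescope to `h4`.
    rw [smul_add, h1, h3, ← mul_smul_comm, sub_eq_iff_eq_add.1 h5.symm, mul_add, h2, ← h4,
      Finset.mul_sum, ← Finset.sum_add_distrib, ← Finset.sum_add_distrib]
    refine Finset.sum_congr rfl fun i _ => ?_
    ring

/-- The Hall form in terms of power sums. -/
noncomputable abbrev hallForm (K : Type*) [CommRing K] : SymFun K →ₗ[K] SymFun K →ₗ[K] K :=
  powerForm K fun k : ℕ+ => (k : ℕ)

/-- Both sides obey the same recursion under `f ↦ p_j f`: the summand `t^j` of the shifted `p_j`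
corresponds to the Leibniz term in which `j ∂/∂p_j` lowers `h_z` to `h_{z-j}`. Integer `z` lets the
induction pass to `z - j`. -/
theorem hallForm_coeff_shift (f g : SymFun K) (z : ℤ) :
    (if 0 ≤ z then hallForm K ((shift K f).coeff z.toNat) g else 0) =
      hallForm K f (completeInt K z * g) := by
  induction f using MvPolynomial.induction_on generalizing g z with
  | C a =>
    rw [powerForm_C, map_mul, constantCoeff_completeInt, ← algebraMap_eq, AlgHom.commutes,
      Polynomial.algebraMap_apply, Polynomial.coeff_C, algebraMap_eq]
    rcases lt_trichotomy z 0 with hz | rfl | hz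
    · rw [if_neg (by omega), if_neg hz.ne, zero_mul, mul_zero]
    · simp [powerForm_C]
    · rw [if_pos hz.le, if_neg (by omega), if_neg hz.ne']
      simp
  | add p q hp hq =>
    rw [map_add (hallForm K), LinearMap.add_apply, ← hp, ← hq]
    split_ifs <;> simp
  | mul_X f j ih =>
    have h : (j : ℕ) • pderiv j (completeInt K z * g) =
        completeInt K z * ((j : ℕ) • pderiv j g) + completeInt K (z - j) * g := by
      rw [Derivation.leibniz, smul_add, smul_eq_mul, smul_eq_mul, mul_comm g, ← mul_smul_comm,
        ← smul_mul_assoc (j : ℕ) (pderiv j (completeInt K z)), pderiv_completeInt]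
    rw [mul_comm f, powerForm_X_mul, h, map_add, ← ih, ← ih]
    have hj := j.pos
    by_cases hz : 0 ≤ z
    · rw [if_pos hz, if_pos hz, map_mul, shift_X, add_mul, Polynomial.coeff_add,
        Polynomial.coeff_C_mul, map_add, LinearMap.add_apply, powerForm_X_mul,
        Polynomial.coeff_X_pow_mul']
      congr 1
      by_cases h : 0 ≤ z - j
      · rw [if_pos (by omega), if_pos h]
        congr 3
        omega
      · rw [if_neg (by omega), if_neg h]
        simp
    · rw [if_neg hz, if_neg hz, if_neg (by omega), zero_add]

end Complete

/-! ### Jacobi-Trudi determinants -/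

theorem coeff_prod_sum_of_natDegree_le {R ι : Type*} [CommSemiring R] (s : Finset ι)
    (f : ι → Polynomial R) (d : ι → ℕ) (h : ∀ i ∈ s, (f i).natDegree ≤ d i) :
    (∏ i ∈ s, f i).coeff (∑ i ∈ s, d i) = ∏ i ∈ s, (f i).coeff (d i) := by
  classical
  induction s using Finset.induction_on with
  | empty => simp
  | insert a s ha ih =>
    rw [Finset.prod_insert ha, Finset.prod_insert ha, Finset.sum_insert ha,
      Polynomial.coeff_mul_add_eq_of_natDegree_le (h a (by simp)) ?_,
      ih fun i hi => h i (by simp [hi])]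
    exact (Polynomial.natDegree_prod_le _ _).trans
      (Finset.sum_le_sum fun i hi => h i (by simp [hi]))

section RowDegree

variable {R : Type*} [CommRing R] {n : Type*} [Fintype n] [DecidableEq n]
  (M : Matrix n n (Polynomial R)) (d : n → ℕ)

theorem natDegree_det_le_of_row (h : ∀ i j, (M i j).natDegree ≤ d i) :
    M.det.natDegree ≤ ∑ i, d i := by
  rw [Matrix.det_apply]
  refine Polynomial.natDegree_sum_le_of_forall_le _ _ fun σ _ => ?_
  refine (Polynomial.natDegree_smul_le _ _).trans ?_
  refine (Polynomial.natDegree_prod_le _ _).trans ?_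
  rw [← Equiv.sum_comp σ d]
  exact Finset.sum_le_sum fun i _ => h _ _

theorem coeff_det_of_row (h : ∀ i j, (M i j).natDegree ≤ d i) :
    M.det.coeff (∑ i, d i) = (Matrix.of fun i j => (M i j).coeff (d i)).det := by
  rw [Matrix.det_apply, Matrix.det_apply, Polynomial.finsetSum_coeff]
  refine Finset.sum_congr rfl fun σ _ => ?_
  rw [Polynomial.coeff_smul, ← Equiv.sum_comp σ d, coeff_prod_sum_of_natDegree_le _ _ _
    fun i _ => h _ _]
  rfl

end RowDegree

/-- Reversing rows and columns reduces this to row operations that use the row above. -/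
theorem det_eq_of_forall_row_eq_smul_add_succ {R : Type*} [CommRing R] {n : ℕ}
    {A B : Matrix (Fin (n + 1)) (Fin (n + 1)) R} (c : Fin n → R)
    (A_last : ∀ j, A (Fin.last n) j = B (Fin.last n) j)
    (A_succ : ∀ (i : Fin n) (j), A i.castSucc j = B i.castSucc j + c i * A i.succ j) :
    A.det = B.det := by
  rw [← Matrix.det_submatrix_equiv_self Fin.revPerm A,
    ← Matrix.det_submatrix_equiv_self Fin.revPerm B]
  refine Matrix.det_eq_of_forall_row_eq_smul_add_pred (fun i => c i.rev) (fun j => ?_)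
    fun i j => ?_
  · simp [A_last]
  · simp [Fin.rev_succ, Fin.rev_castSucc, A_succ]

section JacobiTrudi

variable (K : Type*) [CommRing K] [Algebra ℚ K]

/-- The Jacobi-Trudi determinant `det (h_{a_i - i + j})` with `n` rows. -/
noncomputable def jacobiTrudi (n : ℕ) (a : ℕ → ℕ) : SymFun K :=
  Matrix.det (Matrix.of fun i j : Fin n => completeInt K ((a i : ℤ) - (i : ℕ) + (j : ℕ)))

theorem schur_eq_jacobiTrudi (μ : YoungDiagram) :
    schur K μ = jacobiTrudi K (μ.colLen 0) μ.rowLen := rfl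

theorem shift_completeInt_eq_sum (z : ℤ) (d : ℕ) : shift K (completeInt K z) =
    ∑ m ∈ Finset.range d, Polynomial.C (completeInt K (z - m)) * Polynomial.X ^ m +
      Polynomial.X ^ d * shift K (completeInt K (z - d)) := by
  induction d with
  | zero => simp
  | succ d ih =>
    rw [ih, Finset.sum_range_succ, shift_completeInt K (z - d),
      show z - ((d + 1 : ℕ) : ℤ) = z - d - 1 by push_cast; ring]
    ring

/-- With `d_i = a_i - a_{i+1}`, cutting the expansion of row `i` after `d_i + 1` terms leaves
`t^(d_i + 1)` times the row below, which a row operation removes. Row `i` then has degree at most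
`d_i`, and these bounds telescope to `a_0`. -/
theorem shift_jacobiTrudi {a : ℕ → ℕ} (ha : Antitone a) {n : ℕ} (hn : a (n + 1) = 0) :
    ((shift K (jacobiTrudi K (n + 1) a)).natDegree ≤ a 0) ∧
    (shift K (jacobiTrudi K (n + 1) a)).coeff (a 0) = jacobiTrudi K n fun i => a (i + 1) := by
  set d : Fin (n + 1) → ℕ := fun i => a i - a (i + 1) with hd
  set N : Matrix (Fin (n + 1)) (Fin (n + 1)) (Polynomial (SymFun K)) := Matrix.of fun i j =>
    ∑ m ∈ Finset.range (d i + 1),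
      Polynomial.C (completeInt K ((a i : ℤ) - (i : ℕ) + (j : ℕ) - m)) * Polynomial.X ^ m with hN
  have hdet : shift K (jacobiTrudi K (n + 1) a) = N.det := by
    rw [jacobiTrudi, AlgHom.map_det]
    refine det_eq_of_forall_row_eq_smul_add_succ
      (fun i => Polynomial.X ^ (d i.castSucc + 1)) (fun j => ?_) fun i j => ?_
    · simp only [AlgHom.mapMatrix_apply, Matrix.map_apply, Matrix.of_apply, hN]
      -- There is no row below the last one, but its remainder has index `j - n - 1 < 0`.
      rw [shift_completeInt_eq_sum K _ (d (Fin.last n) + 1), completeInt_of_neg K (by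
        have := j.2
        simp only [hd, Fin.val_last, hn]
        push_cast
        omega), map_zero, mul_zero, add_zero]
    · simp only [AlgHom.mapMatrix_apply, Matrix.map_apply, Matrix.of_apply, hN]
      rw [shift_completeInt_eq_sum K _ (d i.castSucc + 1)]
      congr 4
      have := ha (Nat.le_succ i)
      simp only [hd, Fin.val_castSucc, Fin.val_succ, Nat.succ_eq_add_one] at *
      push_cast
      omega
  have hNd : ∀ i j, (N i j).natDegree ≤ d i := fun i j => by
    rw [hN, Matrix.of_apply]
    refine Polynomial.natDegree_sum_le_of_forall_le _ _ fun m hm => ?_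
    rw [Finset.mem_range] at hm
    exact le_trans (Polynomial.natDegree_C_mul_X_pow_le _ _) (by omega)
  have hsum : ∑ i, d i = a 0 := by
    have h : ∀ k ≤ n + 1, ∑ i ∈ Finset.range k, (a i - a (i + 1)) = a 0 - a k := by
      intro k _
      induction k with
      | zero => simp
      | succ k ih =>
        have := ha (Nat.zero_le k)
        have := ha (Nat.le_succ k)
        rw [Finset.sum_range_succ, ih (by omega), Nat.succ_eq_add_one] at *
        omega
    rw [hd, Finset.sum_fin_eq_sum_range, show a 0 = a 0 - a (n + 1) by omega, ← h _ le_rfl]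
    exact Finset.sum_congr rfl fun i hi => by simp [Finset.mem_range.1 hi]
  rw [hdet, ← hsum]
  refine ⟨natDegree_det_le_of_row N d hNd, ?_⟩
  rw [coeff_det_of_row N d hNd]
  have hentry : ∀ i j : Fin (n + 1), (N i j).coeff (d i) =
      completeInt K ((a (i + 1) : ℤ) - (i : ℕ) + (j : ℕ)) := fun i j => by
    rw [hN, Matrix.of_apply, Polynomial.finsetSum_coeff]
    simp only [Polynomial.coeff_C_mul_X_pow]
    rw [Finset.sum_ite_eq, if_pos (by simp)]
    congr 1
    have := ha (Nat.le_succ i)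
    simp only [hd, Nat.succ_eq_add_one] at *
    omega
  simp only [hentry]
  -- The last row of top coefficients is `h_{j-n}`, that is `(0, …, 0, 1)`.
  rw [Matrix.det_succ_row _ (Fin.last n), Finset.sum_eq_single (Fin.last n)]
  · simp only [Fin.val_last, Matrix.of_apply, hn, Nat.cast_zero, zero_sub, neg_add_cancel,
      completeInt_zero, mul_one, ← two_mul, pow_mul, neg_one_sq, one_pow, one_mul]
    rw [jacobiTrudi]
    congr 1
    ext1 i j
    simp
  · intro j _ hj
    rw [Matrix.of_apply, completeInt_of_neg K, mul_zero, zero_mul]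
    have : (j : ℕ) < n := by
      have h1 : (j : ℕ) ≠ n := fun h => hj (Fin.ext h)
      omega
    simp only [Fin.val_last, hn]
    omega
  · simp

end JacobiTrudi

/-! ### The Hall inner product -/

section Hall

variable (K : Type*) [CommRing K] [Algebra ℚ K]

theorem hallForm_coeff_shift_nat (f g : SymFun K) (r : ℕ) :
    hallForm K ((shift K f).coeff r) g = hallForm K f (complete K r * g) := by
  have := hallForm_coeff_shift K f g r
  simpa [completeInt_natCast] using this

theorem natDegree_shift_jacobiTrudi_le {a : ℕ → ℕ} (ha : Antitone a) {n : ℕ}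
    (hn : ∀ i, 0 < a i ↔ i < n) : (shift K (jacobiTrudi K n a)).natDegree ≤ a 0 := by
  cases n with
  | zero => simp [jacobiTrudi]
  | succ n => exact (shift_jacobiTrudi K ha (by have := hn (n + 1); omega)).1

-- Expand the determinant with the larger first part along its first row and move each entry
-- `h_{b_0+j}` to the other side as an adjoint. Only `j = 0` can survive, and only if `a_0 = b_0`;
-- then both first rows disappear and induction applies.
open Classical in
theorem hallForm_jacobiTrudi {n m : ℕ} {a b : ℕ → ℕ} (ha : Antitone a) (hb : Antitone b)
    (hn : ∀ i, 0 < a i ↔ i < n) (hm : ∀ i, 0 < b i ↔ i < m) :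
    hallForm K (jacobiTrudi K n a) (jacobiTrudi K m b) = if a = b then 1 else 0 := by
  induction hk : n + m using Nat.strong_induction_on generalizing n m a b with
  | _ k ih =>
  wlog hab : a 0 ≤ b 0 generalizing n m a b
  · rw [powerForm_comm, this hb ha hm hn (by omega) (by omega)]
    simp only [eq_comm]
  cases m with
  | zero =>
    have h1 : n = 0 := by
      -- Here `b_0 = 0`, so `a_0 ≤ b_0` forces both sequences to be zero.
      have := hn 0
      have := hm 0
      omega
    subst h1
    have h2 : a = b := funext fun i => by
      have := hn i
      have := hm i
      omega
    rw [if_pos h2, jacobiTrudi, jacobiTrudi, Matrix.det_fin_zero, Matrix.det_fin_zero,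
      powerForm_one, map_one]
  | succ m =>
    have hb0 : 0 < b 0 := (hm 0).2 m.succ_pos
    have hminor : ((Matrix.of fun i j : Fin (m + 1) =>
        completeInt K ((b i : ℤ) - (i : ℕ) + (j : ℕ))).submatrix Fin.succ
          (Fin.succAbove 0)).det = jacobiTrudi K m fun i => b (i + 1) := by
      rw [jacobiTrudi]
      congr 1
      ext1 i j
      simp only [Matrix.submatrix_apply, Matrix.of_apply, Fin.succAbove_zero, Fin.val_succ]
      congr 1
      push_cast
      ring
    rw [jacobiTrudi.eq_1 K (m + 1), Matrix.det_succ_row_zero, map_sum]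
    have hterm : ∀ j : Fin (m + 1), ∀ g, hallForm K (jacobiTrudi K n a) ((-1) ^ (j : ℕ) *
        (Matrix.of fun i j : Fin (m + 1) =>
          completeInt K ((b i : ℤ) - (i : ℕ) + (j : ℕ))) 0 j * g) = (-1) ^ (j : ℕ) *
        hallForm K ((shift K (jacobiTrudi K n a)).coeff (b 0 + j)) g := fun j g => by
      rw [hallForm_coeff_shift_nat, ← completeInt_natCast, ← smul_eq_mul (_ : K), ← map_smul,
        smul_eq_C_mul, ← mul_assoc]
      simp
    have hzero : ∀ j : ℕ, a 0 < b 0 + j →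
        (shift K (jacobiTrudi K n a)).coeff (b 0 + j) = 0 := fun j hj =>
      Polynomial.coeff_eq_zero_of_natDegree_lt
        ((natDegree_shift_jacobiTrudi_le K ha hn).trans_lt hj)
    rw [Finset.sum_eq_single 0, hterm, hminor, Fin.val_zero, pow_zero, one_mul, add_zero]
    · rcases hab.lt_or_eq with hlt | heq
      · have := hzero 0 hlt
        rw [add_zero] at this
        rw [this, map_zero, LinearMap.zero_apply, if_neg]
        rintro rfl
        exact lt_irrefl _ hlt
      · obtain ⟨n', rfl⟩ : ∃ n', n = n' + 1 := ⟨n - 1, by have := hn 0; omega⟩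
        rw [← heq, (shift_jacobiTrudi K ha (by have := hn (n' + 1); omega)).2,
          ih (n' + m) (by omega) (fun i j hij => ha (by omega)) (fun i j hij => hb (by omega))
            (fun i => by rw [hn]; omega) (fun i => by rw [hm]; omega) rfl]
        congr 1
        rw [eq_iff_iff]
        refine ⟨fun h => funext fun i => ?_, fun h => by rw [h]⟩
        cases i with
        | zero => exact heq
        | succ i => exact congrFun h i
    · intro j _ hj
      rw [hterm, hzero, map_zero, LinearMap.zero_apply, mul_zero]
      have : (j : ℕ) ≠ 0 := fun h => hj (Fin.ext h)
      omega
    · simp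

theorem rowLen_pos_iff (μ : YoungDiagram) (i : ℕ) : 0 < μ.rowLen i ↔ i < μ.colLen 0 := by
  rw [← YoungDiagram.mem_iff_lt_rowLen, YoungDiagram.mem_iff_lt_colLen]

theorem rowLen_injective : Function.Injective YoungDiagram.rowLen := by
  intro μ ν h
  ext ⟨i, j⟩
  rw [YoungDiagram.mem_cells, YoungDiagram.mem_cells, YoungDiagram.mem_iff_lt_rowLen,
    YoungDiagram.mem_iff_lt_rowLen, h]

open Classical in
theorem hallForm_schur (μ ν : YoungDiagram) :
    hallForm K (schur K μ) (schur K ν) = if μ = ν then 1 else 0 := by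
  rw [schur_eq_jacobiTrudi, schur_eq_jacobiTrudi, hallForm_jacobiTrudi K
    (fun i j h => μ.rowLen_anti i j h) (fun i j h => ν.rowLen_anti i j h) (rowLen_pos_iff μ)
    (rowLen_pos_iff ν)]
  simp only [rowLen_injective.eq_iff]

theorem hallForm_schur_left (μ : YoungDiagram) (g : SymFun K) :
    hallForm K (schur K μ) g = (schurBasis K).repr g μ := by
  classical
  have : hallForm K (schur K μ) =
      (Finsupp.lapply μ).comp (schurBasis K).repr.toLinearMap := by
    refine (schurBasis K).ext fun ν => ?_
    change _ = (schurBasis K).repr (schurBasis K ν) μ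
    rw [Module.Basis.repr_self, Finsupp.single_apply, schurBasis_apply, hallForm_schur]
    simp only [eq_comm]
  exact congrArg (fun l => l g) this

theorem hall_eq_hallForm (f g : SymFun K) : hall f g = hallForm K f g := by
  rw [hall]
  conv_rhs => rw [← (schurBasis K).linearCombination_repr f]
  rw [Finsupp.linearCombination_apply, Finsupp.sum, Finsupp.sum, map_sum, LinearMap.sum_apply]
  refine Finset.sum_congr rfl fun μ _ => ?_
  rw [map_smul (hallForm K), LinearMap.smul_apply, schurBasis_apply, hallForm_schur_left,
    smul_eq_mul]

theorem schur_row {r : ℕ} (hr : 0 < r) : schur K (row r) = complete K r := by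
  have h1 : (row r).rowLens = [r] := YoungDiagram.rowLens_ofRowLens_eq_self (by simpa using hr)
  have h2 : (row r).colLen 0 = 1 := by rw [← YoungDiagram.length_rowLens, h1, List.length_singleton]
  have h3 : (row r).rowLen 0 = r := YoungDiagram.rowLen_ofRowLens (w := [r]) 0
  rw [schur_eq_jacobiTrudi, h2, jacobiTrudi, Matrix.det_fin_one]
  simp [h3, completeInt_natCast]

/-- By adjointness, the sum defining `perp` is the Schur expansion of this coefficient. -/
theorem perp_schur_row {r : ℕ} (hr : 0 < r) (g : SymFun K) :
    perp (schur K (row r)) g = (shift K g).coeff r := by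
  rw [perp]
  simp only [hall_eq_hallForm, schur_row K hr, ← hallForm_coeff_shift_nat]
  conv_rhs => rw [← (schurBasis K).linearCombination_repr ((shift K g).coeff r)]
  rw [Finsupp.linearCombination_apply, Finsupp.sum, finsum_eq_sum_of_support_subset]
  · refine Finset.sum_congr rfl fun μ _ => ?_
    rw [powerForm_comm, hallForm_schur_left, schurBasis_apply]
  · intro μ hμ
    rw [Function.mem_support, powerForm_comm, hallForm_schur_left] at hμ
    rw [Finset.mem_coe, Finsupp.mem_support_iff]
    intro h
    exact hμ (by rw [h, zero_smul])

end Hall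

/-! ### The iterated coproduct -/

section Coproduct

variable (K : Type*) [CommRing K] {ι : Type*}

/-- The bilinear form on symmetric functions in several alphabets. -/
noncomputable abbrev multiForm (K : Type*) [CommRing K] (ι : Type*) :
    MvPolynomial (ι × ℕ+) K →ₗ[K] MvPolynomial (ι × ℕ+) K →ₗ[K] K :=
  powerForm K fun p : ι × ℕ+ => (p.2 : ℕ)

/-- The symmetric functions in the `i`-th alphabet. -/
noncomputable def alphabet (i : ι) : SymFun K →ₐ[K] MvPolynomial (ι × ℕ+) K :=
  rename (Prod.mk i)

/-- The iterated coproduct `p_k ↦ ∑_i p_k(i)`. -/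
noncomputable def coproduct (ι : Type*) [Fintype ι] : SymFun K →ₐ[K] MvPolynomial (ι × ℕ+) K :=
  aeval fun k => ∑ i, X (i, k)

theorem alphabet_X (i : ι) (k : ℕ+) : alphabet K i (X k) = X (i, k) := by
  simp [alphabet]

theorem pderiv_alphabet_self (i : ι) (k : ℕ+) (f : SymFun K) :
    pderiv (i, k) (alphabet K i f) = alphabet K i (pderiv k f) :=
  pderiv_rename (Prod.mk_right_injective i) k f

theorem pderiv_alphabet_of_ne {i j : ι} (hij : j ≠ i) (k : ℕ+) (f : SymFun K) :
    pderiv (i, k) (alphabet K j f) = 0 := by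
  classical
  refine pderiv_eq_zero_of_notMem_vars fun h => ?_
  obtain ⟨l, -, hl⟩ := Finset.mem_image.1 (vars_rename _ _ h)
  exact hij (congrArg Prod.fst hl)

theorem pderiv_prod_alphabet {i : ι} {s : Finset ι} (hi : i ∉ s) (k : ℕ+) (f : ι → SymFun K) :
    pderiv (i, k) (∏ j ∈ s, alphabet K j (f j)) = 0 := by
  classical
  induction s using Finset.induction_on with
  | empty => simp
  | insert j s hj ih =>
    rw [Finset.mem_insert, not_or] at hi
    rw [Finset.prod_insert hj, Derivation.leibniz, ih hi.2,
      pderiv_alphabet_of_ne K (Ne.symm hi.1), smul_zero, smul_zero, add_zero]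

/-- A variable of alphabet `i` moves across as a derivative, which kills `F`. -/
theorem multiForm_alphabet_mul_right {i : ι} {F G : MvPolynomial (ι × ℕ+) K}
    (hF : ∀ k, pderiv (i, k) F = 0) (g : SymFun K) :
    multiForm K ι F (alphabet K i g * G) = constantCoeff g * multiForm K ι F G := by
  induction g using MvPolynomial.induction_on with
  | C a => simp [alphabet, C_mul']
  | add p q hp hq => rw [map_add, add_mul, map_add, hp, hq, map_add, add_mul]
  | mul_X g k ih =>
    rw [mul_comm g, map_mul (alphabet K i), alphabet_X, mul_assoc, powerForm_mul_X, hF]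
    simp

/-- The form is a tensor product over the alphabets: derivatives in alphabet `i` act on that factor
alone. -/
theorem multiForm_alphabet_mul {i : ι} {F G : MvPolynomial (ι × ℕ+) K}
    (hF : ∀ k, pderiv (i, k) F = 0) (hG : ∀ k, pderiv (i, k) G = 0) (f g : SymFun K) :
    multiForm K ι (alphabet K i f * F) (alphabet K i g * G) =
      hallForm K f g * multiForm K ι F G := by
  induction f using MvPolynomial.induction_on generalizing g with
  | C a =>
    rw [powerForm_C, alphabet, rename_C, C_mul', map_smul (multiForm K ι), LinearMap.smul_apply,
      ← alphabet, multiForm_alphabet_mul_right K hF, smul_eq_mul, mul_assoc]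
  | add p q hp hq =>
    rw [map_add, add_mul, map_add, LinearMap.add_apply, hp, hq, map_add, LinearMap.add_apply,
      add_mul]
  | mul_X f k ih =>
    rw [mul_comm f, map_mul (alphabet K i), alphabet_X, mul_assoc, powerForm_X_mul, powerForm_X_mul, ← ih,
      Derivation.leibniz, hG, smul_zero, zero_add, pderiv_alphabet_self,
      map_nsmul (alphabet K i), smul_mul_assoc,
      smul_eq_mul, mul_comm G]

theorem multiForm_prod_alphabet (s : Finset ι) (f g : ι → SymFun K) :
    multiForm K ι (∏ i ∈ s, alphabet K i (f i)) (∏ i ∈ s, alphabet K i (g i)) =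
      ∏ i ∈ s, hallForm K (f i) (g i) := by
  classical
  induction s using Finset.induction_on with
  | empty => simp [powerForm_one]
  | insert i s hi ih =>
    rw [Finset.prod_insert hi, Finset.prod_insert hi, Finset.prod_insert hi,
      multiForm_alphabet_mul K (fun k => pderiv_prod_alphabet K hi k f)
        (fun k => pderiv_prod_alphabet K hi k g), ih]

variable [Fintype ι]

theorem pderiv_coproduct (i : ι) (k : ℕ+) (f : SymFun K) :
    pderiv (i, k) (coproduct K ι f) = coproduct K ι (pderiv k f) := by
  classical
  induction f using MvPolynomial.induction_on with
  | C a => simp [coproduct]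
  | add p q hp hq => simp only [map_add, hp, hq]
  | mul_X f j ih =>
    have h : pderiv (i, k) (coproduct K ι (X j)) = coproduct K ι (pderiv k (X j)) := by
      rw [coproduct, aeval_X, map_sum, pderiv_X]
      simp only [pderiv_X, Pi.single_apply, Prod.mk.injEq]
      by_cases h : j = k
      · simp [h]
      · simp [h]
    rw [map_mul, Derivation.leibniz, Derivation.leibniz, map_add, smul_eq_mul, smul_eq_mul,
      smul_eq_mul, smul_eq_mul, map_mul, map_mul, ih, h]

theorem constantCoeff_coproduct (f : SymFun K) :
    constantCoeff (coproduct K ι f) = constantCoeff f := by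
  induction f using MvPolynomial.induction_on with
  | C a => simp [coproduct]
  | add p q hp hq => simp only [map_add, hp, hq]
  | mul_X f j ih => simp [coproduct]

/-- The coproduct is adjoint to the multiplication. -/
theorem multiForm_coproduct (f : SymFun K) (G : MvPolynomial (ι × ℕ+) K) :
    multiForm K ι (coproduct K ι f) G = hallForm K f (rename Prod.snd G) := by
  induction G using MvPolynomial.induction_on generalizing f with
  | C a =>
    rw [rename_C, powerForm_comm, powerForm_C, powerForm_comm, powerForm_C,
      constantCoeff_coproduct]
  | add p q hp hq => rw [map_add, map_add, map_add, hp, hq]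
  | mul_X G p ih =>
    obtain ⟨i, k⟩ := p
    rw [mul_comm G, powerForm_mul_X, pderiv_coproduct, ← map_nsmul, ih, map_mul, rename_X,
      powerForm_mul_X]

variable [Algebra ℚ K]

theorem prod_alphabet_mem_span (f : ι → SymFun K) :
    ∏ i, alphabet K i (f i) ∈ Submodule.span K
      (Set.range fun ν : ι → YoungDiagram => ∏ i, alphabet K i (schur K (ν i))) := by
  classical
  set M := Submodule.span K
    (Set.range fun ν : ι → YoungDiagram => ∏ i, alphabet K i (schur K (ν i)))
  -- The product modulo `M` is multilinear in `f`, so it suffices that it vanishes on Schur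
  -- functions.
  have h : M.mkQ.compMultilinearMap ((MultilinearMap.mkPiAlgebra K ι _).compLinearMap
      fun i => (alphabet K i).toLinearMap) = 0 := by
    refine Module.Basis.ext_multilinear (fun _ => schurBasis K) fun ν => ?_
    simp only [LinearMap.compMultilinearMap_apply, MultilinearMap.compLinearMap_apply,
      MultilinearMap.mkPiAlgebra_apply, AlgHom.toLinearMap_apply, schurBasis_apply,
      zero_apply, Submodule.mkQ_apply, Submodule.Quotient.mk_eq_zero]
    exact Submodule.subset_span ⟨ν, rfl⟩
  have := congrArg (fun l => l f) h
  simpa only [LinearMap.compMultilinearMap_apply, MultilinearMap.compLinearMap_apply,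
      MultilinearMap.mkPiAlgebra_apply, AlgHom.toLinearMap_apply,
      zero_apply, Submodule.mkQ_apply, Submodule.Quotient.mk_eq_zero] using this

theorem span_prod_alphabet_schur : Submodule.span K
    (Set.range fun ν : ι → YoungDiagram => ∏ i, alphabet K i (schur K (ν i))) = ⊤ := by
  classical
  set M := Submodule.span K
    (Set.range fun ν : ι → YoungDiagram => ∏ i, alphabet K i (schur K (ν i))) with hM
  -- Generalizing over `f` lets each variable of `G` be absorbed into the factor of its own
  -- alphabet.
  have h : ∀ (G : MvPolynomial (ι × ℕ+) K) (f : ι → SymFun K),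
      G * ∏ i, alphabet K i (f i) ∈ M := by
    intro G
    induction G using MvPolynomial.induction_on with
    | C a =>
      intro f
      rw [C_mul']
      exact M.smul_mem a (prod_alphabet_mem_span K f)
    | add p q hp hq =>
      intro f
      rw [add_mul]
      exact M.add_mem (hp f) (hq f)
    | mul_X G p ih =>
      obtain ⟨i, k⟩ := p
      intro f
      have h1 : ∏ j, alphabet K j ((Pi.mulSingle i (X k) : ι → SymFun K) j) = X (i, k) := by
        rw [Finset.prod_eq_single i]
        · rw [Pi.mulSingle_eq_same, alphabet_X]
        · intro j _ hj
          rw [Pi.mulSingle_eq_of_ne hj, map_one]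
        · simp
      have h2 := ih fun j => (Pi.mulSingle i (X k) : ι → SymFun K) j * f j
      simp only [map_mul, Finset.prod_mul_distrib, h1] at h2
      rwa [mul_assoc]
  refine eq_top_iff.2 fun G _ => ?_
  have := h G 1
  simpa using this

/-- The value of a symmetric function at a sum of alphabets, in terms of Schur functions. -/
theorem exists_aeval_sum_eq (f : SymFun K) : ∃ c : (ι → YoungDiagram) →₀ K,
    (∀ ν, c ν = hall f (∏ i, schur K (ν i))) ∧
      ∀ {R : Type*} [CommRing R] [Algebra K R] (a : ι → ℕ+ → R),
        aeval (fun k => ∑ i, a i k) f =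
          c.sum fun ν x => x • ∏ i, aeval (a i) (schur K (ν i)) := by
  classical
  have hmem : coproduct K ι f ∈ Submodule.span K
      (Set.range fun ν : ι → YoungDiagram => ∏ i, alphabet K i (schur K (ν i))) := by
    rw [span_prod_alphabet_schur]; trivial
  obtain ⟨c, hc⟩ := Finsupp.mem_span_range_iff_exists_finsupp.1 hmem
  refine ⟨c, fun ν => ?_, fun a => ?_⟩
  -- The products of Schur functions are orthonormal, so pairing with one of them reads off its
  -- coefficient.
  · have h1 : multiForm K ι (coproduct K ι f) (∏ i, alphabet K i (schur K (ν i))) =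
        hallForm K f (∏ i, schur K (ν i)) := by
      rw [multiForm_coproduct, map_prod]
      congr 2
      funext i
      rw [alphabet, rename_rename]
      exact rename_id_apply _
    rw [hall_eq_hallForm, ← h1, ← hc, Finsupp.sum, map_sum, LinearMap.sum_apply]
    have h2 : ∀ κ : ι → YoungDiagram, multiForm K ι (∏ i, alphabet K i (schur K (κ i)))
        (∏ i, alphabet K i (schur K (ν i))) = if κ = ν then 1 else 0 := fun κ => by
      rw [multiForm_prod_alphabet]
      simp only [hallForm_schur, Finset.prod_ite_zero, Finset.prod_const_one, Finset.mem_univ,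
        true_implies, funext_iff]
    simp only [map_smul (multiForm K ι), LinearMap.smul_apply, h2, smul_eq_mul, mul_ite, mul_one,
      mul_zero, Finset.sum_ite_eq']
    split_ifs with h
    · rfl
    · exact Finsupp.notMem_support_iff.1 h
  · have h1 : aeval (fun k => ∑ i, a i k) f =
        aeval (fun p : ι × ℕ+ => a p.1 p.2) (coproduct K ι f) := by
      rw [coproduct, ← AlgHom.comp_apply, comp_aeval]
      simp
    rw [h1, ← hc, Finsupp.sum, map_sum]
    refine Finset.sum_congr rfl fun ν _ => ?_
    rw [map_smul, map_prod]
    congr 2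
    funext i
    rw [alphabet, aeval_rename]
    rfl

end Coproduct

/-! ### Homogeneity -/

section Homogeneous

variable (K : Type*) [CommRing K] [Algebra ℚ K]

/-- The degree of the power sums. -/
abbrev psumDegree : ℕ+ → ℕ := fun k => k

theorem isWeightedHomogeneous_complete (n : ℕ) :
    IsWeightedHomogeneous psumDegree (complete K n) n := by
  induction n using Nat.strong_induction_on with
  | _ n ih =>
    cases n with
    | zero =>
      rw [complete]
      exact isWeightedHomogeneous_one K _
    | succ n =>
      rw [complete, ← algebraMap_smul K]
      refine (weightedHomogeneousSubmodule K psumDegree (n + 1)).smul_mem _ ?_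
      refine Submodule.sum_mem _ fun i _ => ?_
      have h1 : IsWeightedHomogeneous psumDegree (powerSum K i) (i + 1) :=
        isWeightedHomogeneous_X K _ _
      have h2 := h1.mul (ih (n - i) (by omega))
      rwa [show (i : ℕ) + 1 + (n - i) = n + 1 by omega] at h2

theorem card_eq_sum_rowLen (μ : YoungDiagram) :
    μ.card = ∑ i : Fin (μ.colLen 0), μ.rowLen i := by
  rw [Fin.sum_univ_eq_sum_range, YoungDiagram.card,
    Finset.card_eq_sum_card_fiberwise (f := Prod.fst) (t := Finset.range (μ.colLen 0))]
  · refine Finset.sum_congr rfl fun i _ => ?_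
    rw [YoungDiagram.rowLen_eq_card, YoungDiagram.row]
  · rintro ⟨i, j⟩ hij
    rw [Finset.coe_range, Set.mem_Iio, ← YoungDiagram.mem_iff_lt_colLen]
    exact μ.up_left_mem le_rfl (Nat.zero_le j) hij

theorem isWeightedHomogeneous_schur (μ : YoungDiagram) :
    IsWeightedHomogeneous psumDegree (schur K μ) μ.card := by
  rw [schur, Matrix.det_apply]
  refine Submodule.sum_mem (weightedHomogeneousSubmodule K psumDegree μ.card) fun σ _ => ?_
  rw [Units.smul_def]
  refine zsmul_mem ?_ _
  simp only [Matrix.of_apply]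
  by_cases hneg : ∃ i, (μ.rowLen (σ i) : ℤ) - (σ i : ℕ) + (i : ℕ) < 0
  · obtain ⟨i, hi⟩ := hneg
    rw [Finset.prod_eq_zero (Finset.mem_univ i) (completeInt_of_neg K hi)]
    exact zero_mem _
  push Not at hneg
  have h := IsWeightedHomogeneous.prod Finset.univ
    (fun i => completeInt K ((μ.rowLen (σ i) : ℤ) - (σ i : ℕ) + (i : ℕ)))
    (fun i => ((μ.rowLen (σ i) : ℤ) - (σ i : ℕ) + (i : ℕ)).toNat) (w := psumDegree)
    (fun i _ => by
      rw [completeInt, if_pos (hneg i)]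
      exact isWeightedHomogeneous_complete K _)
  have hsum : ∑ i, ((μ.rowLen (σ i) : ℤ) - (σ i : ℕ) + (i : ℕ)).toNat = μ.card := by
    rw [card_eq_sum_rowLen]
    zify
    rw [Finset.sum_congr rfl (fun i _ => Int.toNat_of_nonneg (hneg i))]
    simp only [Finset.sum_add_distrib, Finset.sum_sub_distrib]
    rw [Equiv.sum_comp σ (fun i => ((i : ℕ) : ℤ)), Equiv.sum_comp σ (fun i => (μ.rowLen i : ℤ))]
    ring
  rwa [hsum] at h

/-- Every monomial of `f` has `∑ k d_k = n`, so each contributes the same power of `t`. -/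
theorem aeval_X_pow_mul_C (K : Type*) [CommRing K] {A : Type*} [CommRing A] [Algebra K A] {f : SymFun K} {n : ℕ}
    (hf : IsWeightedHomogeneous psumDegree f n) (i : ℕ) (c : ℕ+ → A) :
    aeval (fun k : ℕ+ => Polynomial.X ^ ((k : ℕ) * i) * Polynomial.C (c k)) f =
      Polynomial.X ^ (i * n) * Polynomial.C (aeval c f) := by
  rw [aeval_def, aeval_def, eval₂_eq, eval₂_eq, map_sum, Finset.mul_sum]
  refine Finset.sum_congr rfl fun d hd => ?_
  have h1 : ∏ k ∈ d.support, (Polynomial.X ^ ((k : ℕ) * i) : Polynomial A) ^ d k =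
      Polynomial.X ^ (i * n) := by
    rw [← hf (mem_support_iff.1 hd), Finsupp.weight_apply, Finsupp.sum, Finset.mul_sum,
      ← Finset.prod_pow_eq_pow_sum]
    refine Finset.prod_congr rfl fun k _ => ?_
    rw [← pow_mul, smul_eq_mul]
    congr 1
    ring
  simp only [mul_pow, Finset.prod_mul_distrib, h1, map_mul, map_prod, map_pow,
    Polynomial.algebraMap_apply]
  ring

theorem hall_schur_prod_eq_zero {ι : Type*} [Fintype ι] (lam : YoungDiagram)
    (ν : ι → YoungDiagram) (h : ∑ i, (ν i).card ≠ lam.card) :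
    hall (schur K lam) (∏ i, schur K (ν i)) = 0 := by
  rw [hall_eq_hallForm]
  exact powerForm_eq_zero_of_degree_ne _ psumDegree (isWeightedHomogeneous_schur K lam)
    (IsWeightedHomogeneous.prod _ _ _ fun i _ => isWeightedHomogeneous_schur K (ν i)) h.symm

end Homogeneous

/-! ### Plethysm -/

section Plethysm

variable (K : Type*) [CommRing K] [Algebra ℚ K]

/-- Shifting after `p_k[·]` equals shifting first, then applying `p_k[·]` to coefficients and `t ↦
t^k`: both send `p_l` to `p_{kl} + t^(kl)`. -/
theorem shift_psumPlethysm (k : ℕ+) (g : SymFun ℚ) {N : ℕ} (hN : (shift ℚ g).natDegree < N) :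
    shift K (MvPolynomial.map (algebraMap ℚ K) (psumPlethysm k g)) =
      ∑ i ∈ Finset.range N, Polynomial.X ^ ((k : ℕ) * i) * Polynomial.C
        (MvPolynomial.map (algebraMap ℚ K) (psumPlethysm k ((shift ℚ g).coeff i))) := by
  set Ψ : SymFun ℚ →+* SymFun K := (MvPolynomial.map (algebraMap ℚ K)).comp
    (rename fun l => k * l : SymFun ℚ →ₐ[ℚ] SymFun ℚ).toRingHom with hΨ
  have hΨ' : ∀ f, MvPolynomial.map (algebraMap ℚ K) (psumPlethysm k f) = Ψ f := fun f => rfl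
  have h : (shift K).toRingHom.comp Ψ = ((Polynomial.expand (SymFun K) (k : ℕ)).toRingHom.comp
      (Polynomial.mapRingHom Ψ)).comp (shift ℚ).toRingHom := by
    refine MvPolynomial.ringHom_ext (fun a => ?_) fun l => ?_
    -- Ring homomorphisms out of `ℚ` are unique.
    · have hC : ∀ φ ψ : SymFun ℚ →+* Polynomial (SymFun K), φ (C a) = ψ (C a) := fun φ ψ =>
        RingHom.congr_fun (RingHom.ext_rat (φ.comp C) (ψ.comp C)) a
      exact hC _ _
    · have hl : Ψ (X l) = X (k * l) := by simp [hΨ]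
      simp only [RingHom.comp_apply, AlgHom.toRingHom_eq_coe, RingHom.coe_coe, hl, shift_X,
        Polynomial.coe_mapRingHom, Polynomial.map_C, Polynomial.map_X, map_add, map_pow, Polynomial.expand_C, Polynomial.expand_X,
        PNat.mul_coe, pow_mul]
  have h' := congrArg (fun φ => φ g) h
  simp only [RingHom.comp_apply, AlgHom.toRingHom_eq_coe, RingHom.coe_coe] at h'
  simp only [hΨ']
  rw [h']
  conv_lhs => rw [(shift ℚ g).as_sum_range_C_mul_X_pow' hN]
  rw [map_sum, map_sum]
  refine Finset.sum_congr rfl fun i _ => ?_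
  simp only [Polynomial.coe_mapRingHom, Polynomial.map_C, Polynomial.map_X, map_mul,
    map_pow, Polynomial.expand_C, Polynomial.expand_X]
  rw [← pow_mul, mul_comm]

theorem shift_plethysm (f : SymFun K) (g : SymFun ℚ) : shift K (plethysm f g) =
    aeval (fun k : ℕ+ => shift K (MvPolynomial.map (algebraMap ℚ K) (psumPlethysm k g))) f := by
  rw [plethysm, ← AlgHom.comp_apply, comp_aeval]

theorem shift_coeff_zero (K : Type*) [CommRing K] (g : SymFun K) : (shift K g).coeff 0 = g := by
  induction g using MvPolynomial.induction_on with
  | C a => simp [shift]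
  | add p q hp hq => rw [map_add, Polynomial.coeff_add, hp, hq]
  | mul_X f k ih =>
    rw [map_mul, Polynomial.mul_coeff_zero, ih, shift_X]
    simp [k.pos.ne]

theorem dvd_aeval_sub_aeval {σ R A : Type*} [CommRing R] [CommRing A] [Algebra R A] {x : A}
    {a b : σ → A} (h : ∀ k, x ∣ a k - b k) (f : MvPolynomial σ R) : x ∣ aeval a f - aeval b f := by
  simp only [← Ideal.mem_span_singleton, ← Ideal.Quotient.mk_eq_mk_iff_sub_mem] at h ⊢
  have := fun c : σ → A => comp_aeval_apply (R := R) c (Ideal.Quotient.mkₐ R (Ideal.span {x})) f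
  simp only [Ideal.Quotient.mkₐ_eq_mk] at this
  rw [this, this]
  simp only [h]

/-- Terms beyond `d` vanish; those beyond `r` carry `t^(k i)` with `k i ≥ r + 1`, so dropping them
changes nothing modulo `t^(r+1)`. -/
theorem coeff_shift_plethysm (f : SymFun K) (g : SymFun ℚ) {d : ℕ}
    (hd : (shift ℚ g).natDegree ≤ d) (r : ℕ) :
    (shift K (plethysm f g)).coeff r =
      (aeval (fun k : ℕ+ => ∑ i : Fin (min r d + 1), Polynomial.X ^ ((k : ℕ) * i) * Polynomial.C
        (MvPolynomial.map (algebraMap ℚ K) (psumPlethysm k ((shift ℚ g).coeff i)))) f).coeff r := by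
  rw [shift_plethysm, ← sub_eq_zero, ← Polynomial.coeff_sub]
  refine Polynomial.X_pow_dvd_iff.1 (dvd_aeval_sub_aeval (x := Polynomial.X ^ (r + 1)) (fun k => ?_)
    f) r r.lt_succ_self
  rw [shift_psumPlethysm K k g (Nat.lt_succ_of_le hd), Fin.sum_univ_eq_sum_range fun i =>
    Polynomial.X ^ ((k : ℕ) * i) * Polynomial.C
        (MvPolynomial.map (algebraMap ℚ K) (psumPlethysm k ((shift ℚ g).coeff i))),
    Finset.range_eq_Ico, ← Finset.sum_Ico_consecutive _ (Nat.zero_le _)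
      (show min r d + 1 ≤ d.succ by omega), Finset.range_eq_Ico, add_sub_cancel_left]
  refine Finset.dvd_sum fun i hi => Dvd.dvd.mul_right (pow_dvd_pow _ ?_) _
  rw [Finset.mem_Ico] at hi
  calc r + 1 ≤ i := by omega
    _ ≤ k * i := Nat.le_mul_of_pos_left _ k.pos

end Plethysm

end SymFun

/-! ### The skewing formula for plethysms -/

open SymFun MvPolynomial in
theorem mainTheorem3 (K : Type*) [CommRing K] [Algebra ℚ K] (lam μ : YoungDiagram) (r : ℕ)
    (hr : 0 < r) :
    SymFun.perp (SymFun.schur K (SymFun.row r))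
        (SymFun.plethysm (SymFun.schur K lam) (SymFun.schur ℚ μ)) =
      ∑ᶠ ν ∈ {ν : Fin (min r (μ.rowLen 0) + 1) → YoungDiagram |
          ∑ i, (ν i).card = lam.card ∧ ∑ i : Fin _, i.val * (ν i).card = r},
        SymFun.hall (SymFun.schur K lam) (∏ i, SymFun.schur K (ν i)) •
          (SymFun.plethysm (SymFun.schur K (ν 0)) (SymFun.schur ℚ μ) *
            ∏ i : Fin (min r (μ.rowLen 0)),
              SymFun.plethysm (SymFun.schur K (ν i.succ))
                (SymFun.perp (SymFun.schur ℚ (SymFun.row (i + 1))) (SymFun.schur ℚ μ))) := by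
  classical
  have hd : (shift ℚ (schur ℚ μ)).natDegree ≤ μ.rowLen 0 := by
    rw [schur_eq_jacobiTrudi]
    exact natDegree_shift_jacobiTrudi_le ℚ (fun i j h => μ.rowLen_anti i j h) (rowLen_pos_iff μ)
  obtain ⟨c, hc, hsum⟩ := exists_aeval_sum_eq K (ι := Fin (min r (μ.rowLen 0) + 1)) (schur K lam)
  rw [perp_schur_row K hr, coeff_shift_plethysm K _ _ hd, hsum, Finsupp.sum,
    Polynomial.finsetSum_coeff, finsum_mem_def, finsum_eq_sum_of_support_subset (s := c.support)]
  · refine Finset.sum_congr rfl fun ν hν => ?_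
    -- The first summation condition is automatic on the support of `c`; the second comes from
    -- extracting `t^r`.
    have hcard : ∑ i, (ν i).card = lam.card := by
      by_contra h
      exact Finsupp.mem_support_iff.1 hν (by rw [hc, hall_schur_prod_eq_zero K lam ν h])
    have hprod : ∏ i : Fin (min r (μ.rowLen 0) + 1), aeval (fun k : ℕ+ =>
        Polynomial.X ^ ((k : ℕ) * i) * Polynomial.C (MvPolynomial.map (algebraMap ℚ K)
          (psumPlethysm k ((shift ℚ (schur ℚ μ)).coeff i)))) (schur K (ν i)) =
        Polynomial.X ^ (∑ i : Fin _, i.val * (ν i).card) *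
          Polynomial.C (plethysm (schur K (ν 0)) (schur ℚ μ) *
            ∏ i : Fin (min r (μ.rowLen 0)), plethysm (schur K (ν i.succ))
              (perp (schur ℚ (row (i + 1))) (schur ℚ μ))) := by
      simp only [aeval_X_pow_mul_C K (isWeightedHomogeneous_schur K _)]
      rw [Finset.prod_mul_distrib, Finset.prod_pow_eq_pow_sum, ← map_prod, Fin.prod_univ_succ]
      -- The factor `i = 0` is separate because the coefficient of `t^0` is `s_μ` itself.
      simp only [perp_schur_row ℚ (Nat.succ_pos _), Fin.val_zero, shift_coeff_zero, Fin.val_succ]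
      rfl
    rw [hprod, Polynomial.coeff_smul, Polynomial.coeff_X_pow_mul', Polynomial.coeff_C, hc]
    by_cases h : ∑ i : Fin _, i.val * (ν i).card = r
    · rw [Set.indicator_of_mem (by exact ⟨hcard, h⟩), if_pos h.le, if_pos (by omega)]
    · rw [Set.indicator_of_notMem (fun h' => h h'.2)]
      split_ifs
      · omega
      · rw [smul_zero]
      · rw [smul_zero]
  · intro ν hν
    rw [Finset.mem_coe, Finsupp.mem_support_iff, hc]
    intro h
    refine hν ?_
    rw [Set.indicator_apply, h, zero_smul, ite_self]
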